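/- Let $S$ be a monoid; write $\mathcal P_{fin}(S)$ for the family of non-empty finite subsets of $S$. The monoid $S$ is right amenable if there is a finitely additive probability measure $\mu$ on the family of all subsets of $S$ such that $\mu(\{x\in S: xs\in F\})=\mu(F)$ for all $s\in S$ and $F\subseteq S$. A right Følner net of $S$ is a net $(F_i)_{i\in I}$ in $\mathcal P_{fin}(S)$ such that $\lim_{i}|F_is\setminus F_i|/|F_i|=0$ for every $s\in S$. Let $\mathcal S(S)$ be the set of all functions $f:\mathcal P_{fin}(S)\to\mathbb R$ that are increasing ($f(F)\le f(F')$ if $F\subseteq F'$), subadditive ($f(F\cup F')\le f(F)+f(F')$) and left subinvariant ($f(sF)\le f(F)$ for $s\in S$); such functions are automatically non-negative and bounded on singletons. We say that the Følner average $\mathcal H_S(f)$ of $f:\mathcal P_{fin}(S)\to\mathbb R$ exists if $S$ has a right Følner net and there is a real number, denoted $\mathcal H_S(f)$, such that $\lim_i f(F_i)/|F_i|=\mathcal H_S(f)$ for every right Følner net $(F_i)_{i\in I}$ of $S$. **Theorem (Fubini's Theorem for monoids).** Let $S$ and $C$ be (two-sided) cancellative right amenable monoids, let $\pi:S\to C$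 be a surjective monoid homomorphism, let $N=\pi^{-1}(1)$, and let $\sigma:C\to S$ be a good section of $\pi$, that is, $\pi(\sigma(c))=c$ and $N\sigma(c)=\pi^{-1}(c)=\sigma(c)N$ for every $c\in C$. Let $f\in\mathcal S(S)$. Then $N$ is right amenable; for every $X\in\mathcal P_{fin}(C)$ the Følner average $$\Theta_\sigma(f)(X):=\mathcal H_N\big(Y\mapsto f(Y\sigma(X))\big),\qquad Y\in\mathcal P_{fin}(N),$$ exists; the function $\Theta_\sigma(f)$ belongs to $\mathcal S(C)$; the Følner averages $\mathcal H_S(f)$ and $\mathcal H_C(\Theta_\sigma(f))$ exist; and $$\mathcal H_S(f)=\mathcal H_C(\Theta_\sigma(f)).$$ -/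

import Mathlib

open Filter Topology
open scoped Pointwise

universe u v w

/-- The family of non-empty finite subsets of `X`. -/
abbrev Pfin (X : Type u) : Type u := {F : Finset X // F.Nonempty}

namespace Pfin

/-- The image `g(A)`. -/
noncomputable def image {X : Type u} {Y : Type v} (g : X → Y) (A : Pfin X) : Pfin Y :=
  open Classical in ⟨A.1.image g, A.2.image g⟩

/-- The union `A ∪ B`. -/
noncomputable def union {X : Type u} (A B : Pfin X) : Pfin X :=
  open Classical in ⟨A.1 ∪ B.1, A.2.mono Finset.subset_union_left⟩

/-- The product set `A B = {a b : a ∈ A, b ∈ B}`. -/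
noncomputable def mul {S : Type u} [Mul S] (A B : Pfin S) : Pfin S :=
  open Classical in ⟨A.1 * B.1, A.2.mul B.2⟩

end Pfin

/-- `S` is right amenable: there is a finitely additive probability measure `μ` on all subsets of
`S` with `μ (R_s⁻¹(F)) = μ F` for all `s` and `F`, where `R_s x = x s`. -/
def RightAmenable (S : Type u) [Mul S] : Prop :=
  ∃ μ : Set S → ℝ, (∀ F, 0 ≤ μ F ∧ μ F ≤ 1) ∧ μ Set.univ = 1 ∧
    (∀ F E : Set S, Disjoint F E → μ (F ∪ E) = μ F + μ E) ∧
    ∀ (s : S) (F : Set S), μ ((fun x => x * s) ⁻¹' F) = μ F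

/-- A net `F` of non-empty finite subsets of `S` is a right Følner net if
`|F_i s \ F_i| / |F_i| → 0` for every `s`. -/
def IsRightFolnerNet {S : Type u} [Mul S] {I : Type w} [Preorder I] (F : I → Pfin S) : Prop :=
  open Classical in
  ∀ s : S, Tendsto (fun i => (((F i).1.image (fun x => x * s) \ (F i).1).card : ℝ) /
    ((F i).1.card : ℝ)) atTop (𝓝 0)

/-- The class `𝒮(S)` of increasing, subadditive, left subinvariant functions on the non-empty
finite subsets of a monoid `S`. Non-negativity and boundedness on singletons are automatic, see
`FolnerIntegrable.nonneg` and `FolnerIntegrable.bounded_singletons`. -/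
structure FolnerIntegrable {S : Type u} [Monoid S] (f : Pfin S → ℝ) : Prop where
  increasing : ∀ A B : Pfin S, A.1 ⊆ B.1 → f A ≤ f B
  subadditive : ∀ A B : Pfin S, f (A.union B) ≤ f A + f B
  left_subinvariant : ∀ (s : S) (A : Pfin S), f (A.image (fun x => s * x)) ≤ f A

theorem FolnerIntegrable.nonneg {S : Type u} [Monoid S] {f : Pfin S → ℝ}
    (hf : FolnerIntegrable f) (A : Pfin S) : 0 ≤ f A := by
  have h := hf.subadditive A A
  have e : A.union A = A := Subtype.ext (by simp [Pfin.union])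
  rw [e] at h
  linarith

theorem FolnerIntegrable.bounded_singletons {S : Type u} [Monoid S] {f : Pfin S → ℝ}
    (hf : FolnerIntegrable f) :
    ∃ M : ℝ, 0 ≤ M ∧ ∀ s : S, f ⟨{s}, Finset.singleton_nonempty s⟩ ≤ M := by
  refine ⟨f ⟨{1}, Finset.singleton_nonempty 1⟩, hf.nonneg _, fun s => ?_⟩
  have h := hf.left_subinvariant s ⟨{1}, Finset.singleton_nonempty 1⟩
  simpa [Pfin.image] using h

/-- `a` is the Følner average of `f`: right Følner nets of `S` exist, and `f(F_i) / |F_i| → a` along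
every right Følner net `(F_i)`. Index sets in the universe of `S` are enough, see
`IsFolnerAverage.tendsto`. -/
def IsFolnerAverage {S : Type u} [Mul S] (f : Pfin S → ℝ) (a : ℝ) : Prop :=
  (∃ (I : Type u) (_ : Preorder I) (_ : IsDirectedOrder I) (_ : Nonempty I) (F : I → Pfin S),
    IsRightFolnerNet F) ∧
  ∀ (I : Type u) [Preorder I] [IsDirectedOrder I] [Nonempty I] (F : I → Pfin S),
    IsRightFolnerNet F → Tendsto (fun i => f (F i) / ((F i).1.card : ℝ)) atTop (𝓝 a)

theorem IsFolnerAverage.unique {S : Type u} [Mul S] {f : Pfin S → ℝ} {a b : ℝ}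
    (ha : IsFolnerAverage f a) (hb : IsFolnerAverage f b) : a = b := by
  obtain ⟨⟨I, _, _, _, F, hF⟩, h⟩ := ha
  exact tendsto_nhds_unique (h I F hF) (hb.2 I F hF)

/-- The Følner average is the limit along right Følner nets indexed in any universe. -/
theorem IsFolnerAverage.tendsto {S : Type u} [Mul S] {f : Pfin S → ℝ} {a : ℝ}
    (ha : IsFolnerAverage f a) {I : Type w} [Preorder I] [IsDirectedOrder I] [Nonempty I]
    {F : I → Pfin S} (hF : IsRightFolnerNet F) :
    Tendsto (fun i => f (F i) / ((F i).1.card : ℝ)) atTop (𝓝 a) := by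
  classical
  rw [Metric.tendsto_nhds]
  by_contra hcon
  push Not at hcon
  obtain ⟨ε, hε, hfr⟩ := hcon
  have key : ∀ p : Finset S × ℕ, ∃ i, (∀ s ∈ p.1,
      (((F i).1.image (fun x => x * s) \ (F i).1).card : ℝ) / ((F i).1.card : ℝ)
        < 1 / ((p.2 : ℝ) + 1)) ∧
      ¬ dist (f (F i) / ((F i).1.card : ℝ)) a < ε := by
    intro p
    have h1 : ∀ᶠ i in atTop, ∀ s ∈ p.1,
        (((F i).1.image (fun x => x * s) \ (F i).1).card : ℝ) / ((F i).1.card : ℝ)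
          < 1 / ((p.2 : ℝ) + 1) := by
      rw [Filter.eventually_all_finset]
      intro s _
      exact (hF s).eventually_lt_const (by positivity)
    have hfr' : ∃ᶠ i in atTop, ¬ dist (f (F i) / ((F i).1.card : ℝ)) a < ε :=
      hfr.mono fun i hi => not_lt.2 hi
    obtain ⟨i, hi, hi'⟩ := (hfr'.and_eventually h1).exists
    exact ⟨i, hi', hi⟩
  choose φ hφ hφ' using key
  have hnet : IsRightFolnerNet (fun p => F (φ p)) := by
    intro s
    rw [Metric.tendsto_nhds]
    intro δ hδ
    obtain ⟨n, hn⟩ := exists_nat_one_div_lt hδ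
    filter_upwards [eventually_ge_atTop (({s} : Finset S), n)] with p hp
    have hs : s ∈ p.1 := hp.1 (Finset.mem_singleton_self s)
    have hle : (n : ℝ) ≤ p.2 := by exact_mod_cast hp.2
    rw [Real.dist_eq, sub_zero, abs_of_nonneg (by positivity)]
    refine ((hφ p s hs).trans_le ?_).trans hn
    gcongr
  obtain ⟨p, hp⟩ := ((Metric.tendsto_nhds.1 (ha.2 _ _ hnet)) ε hε).exists
  exact hφ' p hp

open Classical in
/-- The Følner average `𝓗_S(f)`, with junk value `0` where it does not exist. -/
noncomputable def folnerAverage {S : Type u} [Mul S] (f : Pfin S → ℝ) : ℝ :=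
  if h : ∃ a, IsFolnerAverage f a then h.choose else 0

/-- An element `s` is good for `π` if `N s = π⁻¹(π s) = s N`, where `N = π⁻¹(1)`. -/
def IsGoodElement {S : Type u} {C : Type v} [Monoid S] [Monoid C] (π : S →* C) (s : S) : Prop :=
  (fun n => n * s) '' (π ⁻¹' {1}) = π ⁻¹' {π s} ∧ (fun n => s * n) '' (π ⁻¹' {1}) = π ⁻¹' {π s}

/-- A good section of `π` is a section all of whose values are good. -/
def IsGoodSection {S : Type u} {C : Type v} [Monoid S] [Monoid C] (π : S →* C) (σ : C → S) :
    Prop :=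
  (∀ c, π (σ c) = c) ∧ ∀ c, IsGoodElement π (σ c)

/-- The function `f^F : X ↦ f(X F)`. -/
noncomputable def rightTranslate {S : Type u} [Mul S] (f : Pfin S → ℝ) (F : Pfin S) :
    Pfin S → ℝ :=
  fun X => f (X.mul F)

/-- The restriction of `f` to the non-empty finite subsets of a submonoid. -/
noncomputable def restrictPfin {S : Type u} [Monoid S] (N : Submonoid S) (f : Pfin S → ℝ) :
    Pfin N → ℝ :=
  fun Y => f (Y.image Subtype.val)

/-- `Θ_σ(f)(X) = 𝓗_N(f^{σ(X)})`, where `N = π⁻¹(1)`. -/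
noncomputable def folnerTheta {S : Type u} {C : Type v} [Monoid S] [Monoid C] (π : S →* C)
    (σ : C → S) (f : Pfin S → ℝ) : Pfin C → ℝ :=
  fun X => folnerAverage (restrictPfin (MonoidHom.mker π) (rightTranslate f (X.image σ)))

/-! A good section makes `(n, c) ↦ n σ(c)` a bijection from `N × C` to `S`. If `X` is almost
invariant in `C` and then `Y` is almost invariant in `N` (depending on `X`), the product `Y σ(X)`
has `|Y| |X|` elements and is almost invariant in `S` (`eventually_folnerFilter`). So `f(Y σ(X)) /
(|Y| |X|)` is close to `𝓗_S(f)`; the limit in `Y` gives `Θ_σ(f)(X) / |X|`, and the limit in `X`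
gives the equality (`tendsto_theta`).

The averages of `f` on `S` and of `Y ↦ f(Y σ(X))` on `N` exist by the Ornstein-Weiss lemma
(`FolnerIntegrable.exists_tendsto`), once amenability has produced almost invariant sets
(`RightAmenable.neBot_folnerFilter`). Convergence along all Følner nets is encoded as convergence
along the single filter `folnerFilter`. -/

/-! ### Almost invariant sets and the Følner filter. -/

/-- `F` is almost invariant: `|F s \ F| ≤ δ |F|` for all `s ∈ E`. -/
def IsAlmostInvariant {S : Type u} [Mul S] (E : Finset S) (δ : ℝ) (F : Finset S) : Prop :=
  open Classical in ∀ s ∈ E, ((F.image (fun x => x * s) \ F).card : ℝ) ≤ δ * F.card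

theorem IsAlmostInvariant.mono {S : Type u} [Mul S] {E E' : Finset S} {δ δ' : ℝ} {F : Finset S}
    (h : IsAlmostInvariant E δ F) (hE : E' ⊆ E) (hδ : δ ≤ δ') : IsAlmostInvariant E' δ' F :=
  fun s hs => (h s (hE hs)).trans (by gcongr)

/-- The filter on `Pfin S` generated by the almost invariant sets. -/
def folnerFilter (S : Type u) [Mul S] : Filter (Pfin S) :=
  ⨅ p : Finset S × ℕ, 𝓟 {F | IsAlmostInvariant p.1 (1 / ((p.2 : ℝ) + 1)) F.1}

theorem mem_folnerFilter {S : Type u} [Mul S] {U : Set (Pfin S)} :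
    U ∈ folnerFilter S ↔
      ∃ (E : Finset S) (δ : ℝ), 0 < δ ∧ ∀ F : Pfin S, IsAlmostInvariant E δ F.1 → F ∈ U := by
  classical
  rw [folnerFilter, mem_iInf_of_directed]
  · constructor
    · rintro ⟨p, hp⟩
      exact ⟨p.1, _, by positivity, fun F hF => mem_principal.1 hp hF⟩
    · rintro ⟨E, δ, hδ, h⟩
      obtain ⟨n, hn⟩ := exists_nat_one_div_lt hδ
      exact ⟨(E, n), mem_principal.2 fun F hF => h F (hF.mono subset_rfl hn.le)⟩
  · intro p q
    refine ⟨(p.1 ∪ q.1, max p.2 q.2), ?_, ?_⟩ <;>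
    · simp only [ge_iff_le, le_principal_iff, mem_principal]
      intro F hF
      refine hF.mono (by simp) ?_
      gcongr
      simp

theorem eventually_isAlmostInvariant {S : Type u} [Mul S] (E : Finset S) {δ : ℝ} (hδ : 0 < δ) :
    ∀ᶠ F in folnerFilter S, IsAlmostInvariant E δ F.1 :=
  mem_folnerFilter.2 ⟨E, δ, hδ, fun _ h => h⟩

theorem neBot_folnerFilter_iff {S : Type u} [Mul S] : (folnerFilter S).NeBot ↔
    ∀ (E : Finset S) (δ : ℝ), 0 < δ → ∃ F : Finset S, F.Nonempty ∧ IsAlmostInvariant E δ F := by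
  constructor
  · intro _ E δ hδ
    obtain ⟨F, hF⟩ := (eventually_isAlmostInvariant E hδ).exists
    exact ⟨F.1, F.2, hF⟩
  · intro h
    refine ⟨fun hbot => ?_⟩
    have : (∅ : Set (Pfin S)) ∈ folnerFilter S := by rw [hbot]; trivial
    obtain ⟨E, δ, hδ, hF⟩ := mem_folnerFilter.1 this
    obtain ⟨F, hF', hI⟩ := h E δ hδ
    exact hF ⟨F, hF'⟩ hI

theorem IsRightFolnerNet.tendsto_folnerFilter {S : Type u} [Mul S] {I : Type w} [Preorder I]
    {F : I → Pfin S} (hF : IsRightFolnerNet F) : Tendsto F atTop (folnerFilter S) := by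
  classical
  refine tendsto_iInf.2 fun p => tendsto_principal.2 ?_
  simp only [Set.mem_ofPred_eq, IsAlmostInvariant]
  rw [Filter.eventually_all_finset]
  intro s _
  have hp : (0 : ℝ) < 1 / ((p.2 : ℝ) + 1) := by positivity
  filter_upwards [(hF s).eventually_le_const hp] with i hi
  have : (0 : ℝ) < (F i).1.card := by exact_mod_cast (F i).2.card_pos
  convert (div_le_iff₀ this).1 hi

theorem exists_isRightFolnerNet {S : Type u} [Mul S] [h : (folnerFilter S).NeBot] :
    ∃ F : Finset S × ℕ → Pfin S, IsRightFolnerNet F := by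
  classical
  have key := neBot_folnerFilter_iff.1 h
  have key' : ∀ p : Finset S × ℕ, ∃ F : Pfin S,
      IsAlmostInvariant p.1 (1 / ((p.2 : ℝ) + 1)) F.1 := fun p => by
    obtain ⟨F, hF, hI⟩ := key p.1 (1 / ((p.2 : ℝ) + 1)) (by positivity)
    exact ⟨⟨F, hF⟩, hI⟩
  choose F hF using key'
  refine ⟨F, fun s => ?_⟩
  rw [Metric.tendsto_nhds]
  intro δ hδ
  obtain ⟨n, hn⟩ := exists_nat_one_div_lt hδ
  filter_upwards [eventually_ge_atTop (({s} : Finset S), n)] with p hp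
  have hle : (n : ℝ) ≤ p.2 := by exact_mod_cast hp.2
  have hpos : (0 : ℝ) < (F p).1.card := by exact_mod_cast (F p).2.card_pos
  rw [Real.dist_eq, sub_zero, abs_of_nonneg (by positivity)]
  refine lt_of_le_of_lt ?_ hn
  rw [div_le_iff₀ hpos]
  have := (hF p).mono (E' := {s}) (δ' := 1 / ((n : ℝ) + 1)) hp.1 (by gcongr) s (by simp)
  convert this

/-- Every Følner net tends to the filter, and the index set `Finset S × ℕ` of the net that witnesses
existence stays in the universe of `S`. -/
theorem isFolnerAverage_of_tendsto {S : Type u} [Mul S] [(folnerFilter S).NeBot]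
    {f : Pfin S → ℝ} {a : ℝ}
    (h : Tendsto (fun F => f F / (F.1.card : ℝ)) (folnerFilter S) (𝓝 a)) :
    IsFolnerAverage f a := by
  classical
  refine ⟨?_, fun I _ _ _ F hF => h.comp hF.tendsto_folnerFilter⟩
  obtain ⟨F, hF⟩ := exists_isRightFolnerNet (S := S)
  exact ⟨Finset S × ℕ, inferInstance, inferInstance, inferInstance, F, hF⟩

theorem IsFolnerAverage.folnerAverage_eq {S : Type u} [Mul S] {f : Pfin S → ℝ} {a : ℝ}
    (h : IsFolnerAverage f a) : folnerAverage f = a := by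
  have hex : ∃ a, IsFolnerAverage f a := ⟨a, h⟩
  rw [folnerAverage, dif_pos hex]
  exact hex.choose_spec.unique h

/-! ### Amenability yields almost invariant sets. -/

section Amenable

/-- A finitely additive right invariant measure is preserved by injective maps that move each
point by right multiplication with one of finitely many elements. -/
theorem measure_image_eq_of_piecewise_translation {S : Type u} [Mul S] [IsRightCancelMul S]
    {μ : Set S → ℝ}
    (hadd : ∀ F E : Set S, Disjoint F E → μ (F ∪ E) = μ F + μ E)
    (hinv : ∀ (s : S) (F : Set S), μ ((fun x => x * s) ⁻¹' F) = μ F)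
    {k : S → S} (hinj : Function.Injective fun x => x * k x) (K : Finset S) :
    ∀ A : Set S, (∀ x ∈ A, k x ∈ K) → μ ((fun x => x * k x) '' A) = μ A := by
  classical
  have h0 : μ ∅ = 0 := by
    have := hadd ∅ ∅ (by simp)
    simp only [Set.union_self] at this
    linarith
  induction K using Finset.induction_on with
  | empty =>
    intro A hA
    have : A = ∅ := Set.eq_empty_of_forall_notMem fun x hx => by simpa using hA x hx
    simp [this, h0]
  | insert t K _ ih =>
    intro A hA
    set B := A ∩ {x | k x = t}
    set D := A \ {x | k x = t}
    have hBD : Disjoint B D := Set.disjoint_sdiff_right.mono_left Set.inter_subset_right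
    have hA' : A = B ∪ D := (Set.inter_union_sdiff _ _).symm
    have hB : μ ((fun x => x * k x) '' B) = μ B := by
      -- On `B` the map is right multiplication by `t`, and by cancellation the preimage of `B t`
      -- under it is exactly `B`.
      rw [← hinv t ((fun x => x * k x) '' B)]
      congr 1
      ext x
      constructor
      · rintro ⟨y, hy, hyx⟩
        have hyx' : y * k y = x * t := hyx
        rw [show k y = t from hy.2] at hyx'
        rwa [← mul_right_cancel hyx']
      · intro hx
        exact ⟨x, hx, by simp only; rw [hx.2]⟩
    have hD : μ ((fun x => x * k x) '' D) = μ D := ih D fun x hx =>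
      (Finset.mem_insert.1 (hA x hx.1)).resolve_left hx.2
    rw [hA', Set.image_union, hadd _ _ hBD, hadd _ _ (Set.disjoint_image_of_injective hinj hBD),
      hB, hD]

open Classical in
theorem card_mul_pow_growth {S : Type u} [Monoid S] {E : Finset S} {r : ℝ} (hr : 0 ≤ r)
    (h : ∀ F : Finset S, r * F.card ≤ (F * E).card) (n : ℕ) (F : Finset S) :
    r ^ n * F.card ≤ (F * E ^ n).card := by
  induction n generalizing F with
  | zero => simp
  | succ n ih =>
    rw [pow_succ' E, ← mul_assoc]
    refine le_trans ?_ (ih (F * E))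
    rw [pow_succ, mul_assoc]
    gcongr
    exact h F

/-- Without almost invariant sets, multiplication by a fixed finite set expands every finite set by
a factor `1 + δ`, and a power `K` of it doubles every finite set. Hall's marriage theorem then gives
two injections of `S` with disjoint images, each moving points by elements of `K`. Both images have
measure `1`, contradicting total mass `1`. -/
theorem RightAmenable.neBot_folnerFilter {S : Type u} [Monoid S] [IsRightCancelMul S]
    (hS : RightAmenable S) : (folnerFilter S).NeBot := by
  classical
  rw [neBot_folnerFilter_iff]
  intro E δ hδ
  by_contra! hcon
  have grow : ∀ F : Finset S, (1 + δ) * F.card ≤ (F * insert 1 E).card := by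
    intro F
    rcases F.eq_empty_or_nonempty with rfl | hF
    · simp
    have := hcon F hF
    simp only [IsAlmostInvariant, not_forall, not_le] at this
    obtain ⟨s, hs, hlt⟩ := this
    have hsub : F ∪ (F.image (fun x => x * s) \ F) ⊆ F * insert 1 E := by
      intro x hx
      rcases Finset.mem_union.1 hx with hx | hx
      · exact Finset.mem_mul.2 ⟨x, hx, 1, by simp, by simp⟩
      · obtain ⟨y, hy, rfl⟩ := Finset.mem_image.1 (Finset.mem_sdiff.1 hx).1
        exact Finset.mul_mem_mul hy (by simp [hs])
    have hc := Finset.card_le_card hsub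
    rw [Finset.card_union_of_disjoint Finset.disjoint_sdiff] at hc
    have hc' : (F.card : ℝ) + (F.image (fun x => x * s) \ F).card ≤ (F * insert 1 E).card := by
      exact_mod_cast hc
    have hlt' : δ * F.card < ((F.image (fun x => x * s) \ F).card : ℝ) := by convert hlt
    linarith
  obtain ⟨n, hn⟩ := pow_unbounded_of_one_lt 2 (by linarith : 1 < 1 + δ)
  set K := (insert 1 E) ^ n
  have dbl : ∀ F : Finset S, 2 * F.card ≤ (F * K).card := by
    intro F
    have h1 := card_mul_pow_growth (by linarith) grow n F
    have h2 : (2 : ℝ) * F.card ≤ (F * K).card := by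
      refine le_trans ?_ h1
      gcongr
    exact_mod_cast h2
  -- Hall's condition for two copies of `S`: a set is at most twice as large as its projection,
  -- which `K` doubles.
  have hall : ∀ A : Finset (S × Bool), A.card ≤ (A.biUnion fun p => {p.1} * K).card := by
    intro A
    have h1 : A ⊆ A.image Prod.fst ×ˢ Finset.univ := fun p hp =>
      Finset.mem_product.2 ⟨Finset.mem_image_of_mem _ hp, Finset.mem_univ _⟩
    have h2 : A.image Prod.fst * K ⊆ A.biUnion fun p => {p.1} * K := by
      intro y hy
      obtain ⟨x, hx, k, hk, rfl⟩ := Finset.mem_mul.1 hy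
      obtain ⟨p, hp, rfl⟩ := Finset.mem_image.1 hx
      exact Finset.mem_biUnion.2 ⟨p, hp, Finset.mul_mem_mul (by simp) hk⟩
    have h3 := Finset.card_le_card h1
    rw [Finset.card_product, Finset.card_univ, Fintype.card_bool] at h3
    have h4 := dbl (A.image Prod.fst)
    have h5 := Finset.card_le_card h2
    omega
  obtain ⟨φ, hφ, hφK⟩ := (Finset.all_card_le_biUnion_card_iff_exists_injective _).1 hall
  have hk : ∀ p : S × Bool, ∃ k ∈ K, p.1 * k = φ p := fun p => by
    obtain ⟨x, hx, k, hk, h⟩ := Finset.mem_mul.1 (hφK p)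
    exact ⟨k, hk, by rw [← h, Finset.mem_singleton.1 hx]⟩
  choose k hkK hk using hk
  obtain ⟨μ, h01, h1, hadd, hinv⟩ := hS
  have hφb : ∀ b, (fun x => x * k (x, b)) = fun x => φ (x, b) := fun b =>
    funext fun x => hk (x, b)
  have hinj : ∀ b, Function.Injective fun x => x * k (x, b) := fun b => by
    rw [hφb]
    intro x y hxy
    simpa using hφ hxy
  have hμ : ∀ b, μ ((fun x => φ (x, b)) '' Set.univ) = 1 := fun b => by
    rw [← hφb, measure_image_eq_of_piecewise_translation hadd hinv (k := fun x => k (x, b))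
      (hinj b) K Set.univ fun x _ => hkK _, h1]
  have hdisj : Disjoint ((fun x => φ (x, true)) '' Set.univ)
      ((fun x => φ (x, false)) '' Set.univ) := by
    rw [Set.disjoint_left]
    rintro _ ⟨x, _, rfl⟩ ⟨y, _, hxy⟩
    simpa using hφ hxy
  have h2 := hadd _ _ hdisj
  rw [hμ, hμ] at h2
  have h3 := (h01 ((fun x => φ (x, true)) '' Set.univ ∪ (fun x => φ (x, false)) '' Set.univ)).2
  linarith

end Amenable

/-! ### The Ornstein-Weiss lemma. -/

section OrnsteinWeiss

open Classical in
/-- The extension of a function on `Pfin S` to all finite sets by `0` at the empty set. -/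
noncomputable def Pfin.extend {S : Type u} (f : Pfin S → ℝ) (A : Finset S) : ℝ :=
  if h : A.Nonempty then f ⟨A, h⟩ else 0

theorem Pfin.extend_coe {S : Type u} (f : Pfin S → ℝ) (A : Pfin S) : Pfin.extend f A.1 = f A :=
  dif_pos A.2

theorem Pfin.extend_empty {S : Type u} (f : Pfin S → ℝ) : Pfin.extend f ∅ = 0 :=
  dif_neg (by simp)

namespace FolnerIntegrable

variable {S : Type u} [Monoid S] {f : Pfin S → ℝ}

theorem extend_nonneg (hf : FolnerIntegrable f) (A : Finset S) : 0 ≤ Pfin.extend f A := by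
  rw [Pfin.extend]
  split_ifs
  · exact hf.nonneg _
  · exact le_rfl

theorem extend_mono (hf : FolnerIntegrable f) {A B : Finset S} (h : A ⊆ B) :
    Pfin.extend f A ≤ Pfin.extend f B := by
  rcases A.eq_empty_or_nonempty with rfl | hA
  · rw [Pfin.extend_empty]
    exact hf.extend_nonneg B
  · rw [Pfin.extend_coe f ⟨A, hA⟩, Pfin.extend_coe f ⟨B, hA.mono h⟩]
    exact hf.increasing _ _ h

open Classical in
theorem extend_union_le (hf : FolnerIntegrable f) (A B : Finset S) :
    Pfin.extend f (A ∪ B) ≤ Pfin.extend f A + Pfin.extend f B := by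
  rcases A.eq_empty_or_nonempty with rfl | hA
  · simp [Pfin.extend_empty]
  rcases B.eq_empty_or_nonempty with rfl | hB
  · simp [Pfin.extend_empty]
  have := hf.subadditive ⟨A, hA⟩ ⟨B, hB⟩
  rwa [← Pfin.extend_coe f, ← Pfin.extend_coe f, ← Pfin.extend_coe f] at this

open Classical in
theorem extend_image_mul_left_le (hf : FolnerIntegrable f) (s : S) (A : Finset S) :
    Pfin.extend f (A.image fun x => s * x) ≤ Pfin.extend f A := by
  rcases A.eq_empty_or_nonempty with rfl | hA
  · simp
  have := hf.left_subinvariant s ⟨A, hA⟩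
  rwa [← Pfin.extend_coe f, ← Pfin.extend_coe f] at this

open Classical in
theorem extend_mul_le (hf : FolnerIntegrable f) (T K : Finset S) :
    Pfin.extend f (T * K) ≤ T.card * Pfin.extend f K := by
  induction T using Finset.induction_on with
  | empty => simp [Pfin.extend_empty]
  | insert x T hx ih =>
    rw [Finset.insert_eq, Finset.union_mul, ← Finset.insert_eq, Finset.card_insert_of_notMem hx]
    refine (hf.extend_union_le _ _).trans ?_
    have := hf.extend_image_mul_left_le x K
    rw [show K.image (fun y => x * y) = {x} * K by ext; simp only [Finset.mem_image, Finset.mem_mul,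
      Finset.mem_singleton, exists_eq_left]] at this
    push_cast
    linarith

theorem exists_extend_le_mul_card (hf : FolnerIntegrable f) :
    ∃ M : ℝ, 0 ≤ M ∧ ∀ A : Finset S, Pfin.extend f A ≤ M * A.card := by
  classical
  obtain ⟨M, hM, h⟩ := hf.bounded_singletons
  refine ⟨M, hM, fun A => ?_⟩
  induction A using Finset.induction_on with
  | empty => simp [Pfin.extend_empty]
  | insert x A hx ih =>
    rw [Finset.card_insert_of_notMem hx, Finset.insert_eq]
    refine (hf.extend_union_le _ _).trans ?_
    have := h x
    rw [← Pfin.extend_coe f] at this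
    push_cast
    linarith

end FolnerIntegrable

variable {S : Type u} [Monoid S] [IsCancelMul S]

open Classical in
/-- A greedy choice of translates `x K` with `x ∈ I` that are almost disjoint, while every further
translate meets their union substantially. -/
theorem exists_greedy_translates (K I : Finset S) {ε : ℝ} (hε : ε ≤ 1) :
    ∃ T ⊆ I, (1 - ε) * (T.card * K.card) ≤ (T * K).card ∧
      ∀ x ∈ I, ε * K.card ≤ (({x} * K) ∩ (T * K)).card := by
  induction I using Finset.induction_on with
  | empty => exact ⟨∅, by simp⟩
  | insert t I ht ih =>
    obtain ⟨T, hTI, hT, hI⟩ := ih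
    have hcard : (({t} * K).card : ℝ) = K.card := by rw [Finset.card_singleton_mul]
    by_cases h : ε * K.card ≤ (({t} * K) ∩ (T * K)).card
    · refine ⟨T, hTI.trans (Finset.subset_insert _ _), hT, fun x hx => ?_⟩
      rcases Finset.mem_insert.1 hx with rfl | hx
      · exact h
      · exact hI x hx
    -- The translate `t K` meets the union in fewer than `ε |K|` points, so adding `t` to `T`
    -- contributes at least `(1 - ε) |K|` new ones.
    · push Not at h
      have hmul : insert t T * K = ({t} * K) ∪ (T * K) := by
        rw [Finset.insert_eq, Finset.union_mul]
      refine ⟨insert t T, Finset.insert_subset_insert _ hTI, ?_, fun x hx => ?_⟩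
      · rw [Finset.card_insert_of_notMem fun h => ht (hTI h), hmul]
        have h1 : ((({t} * K) ∪ (T * K)).card : ℝ) + (({t} * K) ∩ (T * K)).card =
            ({t} * K).card + (T * K).card := by
          exact_mod_cast Finset.card_union_add_card_inter _ _
        push_cast
        linarith
      · rw [hmul]
        rcases Finset.mem_insert.1 hx with rfl | hx
        · rw [Finset.inter_eq_left.2 Finset.subset_union_left, hcard]
          exact mul_le_of_le_one_left (by positivity) hε
        · refine (hI x hx).trans ?_
          gcongr
          exact Finset.subset_union_right

-- Double counting: for fixed `u`, each `k ∈ K` admits at most one `x` with `x k = u`, so `u` lies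
-- in at most `|K|` of the translates.
open Classical in
theorem sum_card_translate_inter_le (K I U : Finset S) :
    ∑ x ∈ I, (({x} * K) ∩ U).card ≤ U.card * K.card := by
  calc ∑ x ∈ I, (({x} * K) ∩ U).card
      = ∑ x ∈ I, ∑ u ∈ U, if u ∈ {x} * K then 1 else 0 := by
        refine Finset.sum_congr rfl fun x _ => ?_
        rw [Finset.inter_comm, ← Finset.filter_mem_eq_inter, Finset.card_filter]
    _ = ∑ u ∈ U, ∑ x ∈ I, if u ∈ {x} * K then 1 else 0 := Finset.sum_comm
    _ ≤ ∑ u ∈ U, K.card := by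
        refine Finset.sum_le_sum fun u _ => ?_
        rw [← Finset.card_filter]
        have hk : ∀ x ∈ I.filter (fun x => u ∈ {x} * K), ∃ k ∈ K, x * k = u := fun x hx => by
          obtain ⟨y, hy, k, hk, h⟩ := Finset.mem_mul.1 (Finset.mem_filter.1 hx).2
          exact ⟨k, hk, by rw [← h, Finset.mem_singleton.1 hy]⟩
        choose! k hkK hk using hk
        refine Finset.card_le_card_of_injOn k hkK fun x hx y hy hxy => ?_
        have h1 := hk x hx
        rw [hxy, ← hk y hy] at h1
        exact mul_right_cancel h1
    _ = U.card * K.card := by rw [Finset.sum_const, smul_eq_mul]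

-- Such an `x` has `x k ∉ F` for some `k ∈ K`, and for each `k` right multiplication by `k` injects
-- these points into `F k \ F`.
open Classical in
theorem card_filter_not_translate_subset_le {K F : Finset S} {δ : ℝ}
    (h : IsAlmostInvariant K δ F) :
    ((F.filter fun x => ¬ {x} * K ⊆ F).card : ℝ) ≤ K.card * (δ * F.card) := by
  have h1 : (F.filter fun x => ¬ {x} * K ⊆ F) ⊆ K.biUnion fun k => F.filter fun x => x * k ∉ F := by
    intro x hx
    obtain ⟨hxF, hx⟩ := Finset.mem_filter.1 hx
    obtain ⟨y, hy, hyF⟩ := Finset.not_subset.1 hx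
    obtain ⟨z, hz, k, hk, rfl⟩ := Finset.mem_mul.1 hy
    rw [Finset.mem_singleton.1 hz] at hyF
    exact Finset.mem_biUnion.2 ⟨k, hk, Finset.mem_filter.2 ⟨hxF, hyF⟩⟩
  have h2 : ∀ k ∈ K, ((F.filter fun x => x * k ∉ F).card : ℝ) ≤ δ * F.card := fun k hk => by
    refine le_trans ?_ (h k hk)
    norm_cast
    refine Finset.card_le_card_of_injOn (fun x => x * k) (fun x hx => ?_) fun x _ y _ hxy =>
      mul_right_cancel hxy
    have hx := Finset.mem_filter.1 hx
    exact Finset.mem_sdiff.2 ⟨Finset.mem_image_of_mem _ hx.1, hx.2⟩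
  calc ((F.filter fun x => ¬ {x} * K ⊆ F).card : ℝ)
      ≤ ∑ k ∈ K, ((F.filter fun x => x * k ∉ F).card : ℝ) := by
        exact_mod_cast (Finset.card_le_card h1).trans Finset.card_biUnion_le
    _ ≤ ∑ k ∈ K, δ * F.card := Finset.sum_le_sum h2
    _ = _ := by rw [Finset.sum_const, nsmul_eq_mul]

open Classical in
theorem card_image_mul_right_sdiff_comm (F : Finset S) (s : S) :
    (F \ F.image fun x => x * s).card = (F.image (fun x => x * s) \ F).card :=
  Finset.card_sdiff_comm
    (Finset.card_image_of_injective F (mul_left_injective s)).symm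

open Classical in
/-- Removing a union of translates of an almost invariant set preserves almost invariance. -/
theorem card_image_sdiff_translates_le (F T K : Finset S) (s : S) :
    ((F \ (T * K)).image (fun x => x * s) \ (F \ (T * K))).card ≤
      (F.image (fun x => x * s) \ F).card + T.card * (K.image (fun x => x * s) \ K).card := by
  have hsub : (F \ (T * K)).image (fun x => x * s) \ (F \ (T * K)) ⊆
      (F.image (fun x => x * s) \ F) ∪ T * (K \ K.image fun x => x * s) := by
    intro u hu
    obtain ⟨hu1, hu2⟩ := Finset.mem_sdiff.1 hu
    obtain ⟨y, hy, rfl⟩ := Finset.mem_image.1 hu1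
    obtain ⟨hyF, hyU⟩ := Finset.mem_sdiff.1 hy
    -- If `y s` stays in `F`, it lies in some `x K`, but not in `x K s`, since cancelling `s` would
    -- put `y` in `T K`. The set `K \ K s` has the size of `K s \ K`.
    by_cases hF : y * s ∈ F
    · have hU : y * s ∈ T * K := by
        by_contra h
        exact hu2 (Finset.mem_sdiff.2 ⟨hF, h⟩)
      obtain ⟨x, hx, k, hk, hxk⟩ := Finset.mem_mul.1 hU
      refine Finset.mem_union_right _ (Finset.mem_mul.2 ⟨x, hx, k, ?_, hxk⟩)
      refine Finset.mem_sdiff.2 ⟨hk, fun hks => hyU ?_⟩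
      obtain ⟨k', hk', rfl⟩ := Finset.mem_image.1 hks
      rw [← mul_assoc] at hxk
      exact Finset.mem_mul.2 ⟨x, hx, k', hk', mul_right_cancel hxk⟩
    · exact Finset.mem_union_left _ (Finset.mem_sdiff.2 ⟨Finset.mem_image_of_mem _ hyF, hF⟩)
  refine (Finset.card_le_card hsub).trans ((Finset.card_union_le _ _).trans ?_)
  gcongr
  rw [← card_image_mul_right_sdiff_comm]
  exact Finset.card_mul_le

open Classical in
/-- The inductive step of the Ornstein-Weiss lemma: cover a part of `F` by almost disjoint
translates of a set `K` with small average, and apply the previous bound to the rest. -/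
theorem FolnerIntegrable.bound_step {f : Pfin S → ℝ} (hf : FolnerIntegrable f) {M l ε α : ℝ}
    (hM0 : 0 ≤ M) (hM : ∀ A : Finset S, Pfin.extend f A ≤ M * A.card) (hl : 0 ≤ l)
    (hε0 : 0 < ε) (hε1 : ε < 1) (hα : 0 < α)
    (hK : ∀ (E : Finset S) (δ : ℝ), 0 < δ → ∃ K : Finset S, K.Nonempty ∧
      IsAlmostInvariant E δ K ∧ Pfin.extend f K ≤ l * K.card)
    (h : ∃ (E : Finset S) (δ : ℝ), 0 < δ ∧ ∀ F : Finset S, IsAlmostInvariant E δ F →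
      Pfin.extend f F ≤ (l / (1 - ε) + α * M) * F.card) :
    ∃ (E : Finset S) (δ : ℝ), 0 < δ ∧ ∀ F : Finset S, IsAlmostInvariant E δ F →
      Pfin.extend f F ≤ (l / (1 - ε) + α * (1 - ε / 2) * M) * F.card := by
  obtain ⟨E, δ, hδ, hP⟩ := h
  have hε1' : 0 < 1 - ε := by linarith
  set η := α * (1 - ε / 2) with hη
  have hη0 : 0 < η := mul_pos hα (by linarith)
  -- Since `(1 - ε) |T| |K| ≤ |F|`, the translates of `K` contribute at most `δ η |F| / 2` to the
  -- boundary of `F \ U`; `F` itself contributes as much again.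
  obtain ⟨K, hKne, hKI, hKl⟩ := hK E (δ * η * (1 - ε) / 2) (by positivity)
  have hKpos : (0 : ℝ) < K.card := by exact_mod_cast hKne.card_pos
  -- The second term of the minimum ensures `x K ⊆ F` for at least half of the `x ∈ F`.
  refine ⟨E ∪ K, min (δ * η / 2) (1 / (2 * K.card)), by positivity, fun F hF => ?_⟩
  have hFE : IsAlmostInvariant E (δ * η / 2) F := hF.mono Finset.subset_union_left (min_le_left _ _)
  have hFK : IsAlmostInvariant K (1 / (2 * K.card)) F :=
    hF.mono Finset.subset_union_right (min_le_right _ _)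
  set I := F.filter fun x => {x} * K ⊆ F with hI
  have hIcard : (F.card : ℝ) / 2 ≤ I.card := by
    have h1 := card_filter_not_translate_subset_le hFK
    have h2 : (I.card : ℝ) + (F.filter fun x => ¬ {x} * K ⊆ F).card = F.card := by
      exact_mod_cast Finset.card_filter_add_card_filter_not (s := F) fun x => {x} * K ⊆ F
    have h3 : (K.card : ℝ) * (1 / (2 * K.card) * F.card) = F.card / 2 := by field_simp
    linarith
  obtain ⟨T, hTI, hTcard, hTinter⟩ := exists_greedy_translates K I hε1.le
  set U := T * K with hU
  have hUF : U ⊆ F := by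
    intro u hu
    obtain ⟨x, hx, k, hk, rfl⟩ := Finset.mem_mul.1 hu
    exact (Finset.mem_filter.1 (hTI hx)).2 (Finset.mul_mem_mul (by simp) hk)
  have hUcard : ε / 2 * F.card ≤ U.card := by
    have h1 : I.card * (ε * K.card) ≤ ∑ x ∈ I, ((({x} * K) ∩ U).card : ℝ) := by
      rw [← nsmul_eq_mul]
      exact Finset.card_nsmul_le_sum _ _ _ hTinter
    have h2 : ∑ x ∈ I, ((({x} * K) ∩ U).card : ℝ) ≤ U.card * K.card := by
      exact_mod_cast sum_card_translate_inter_le K I U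
    have h3 : (I.card * ε) * K.card ≤ U.card * K.card := by linarith
    have h4 := le_of_mul_le_mul_right h3 hKpos
    nlinarith
  have hTK : (T.card : ℝ) * K.card ≤ U.card / (1 - ε) := by
    rw [le_div_iff₀ hε1']
    linarith
  have hUle : (U.card : ℝ) ≤ F.card := by exact_mod_cast Finset.card_le_card hUF
  have hfU : Pfin.extend f U ≤ l / (1 - ε) * U.card := by
    calc Pfin.extend f U ≤ T.card * Pfin.extend f K := hf.extend_mul_le T K
      _ ≤ T.card * (l * K.card) := by gcongr
      _ = l * (T.card * K.card) := by ring
      _ ≤ l * (U.card / (1 - ε)) := by gcongr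
      _ = _ := by ring
  have hcardsd : ((F \ U).card : ℝ) = F.card - U.card := Finset.cast_card_sdiff hUF
  have hfF : Pfin.extend f F ≤ Pfin.extend f U + Pfin.extend f (F \ U) := by
    have := hf.extend_union_le U (F \ U)
    rwa [Finset.union_sdiff_of_subset hUF] at this
  have hl' : 0 ≤ l / (1 - ε) := by positivity
  -- A remainder smaller than `η |F|` is absorbed by the trivial bound `M`. A larger one is almost
  -- invariant, so the previous bound applies to it, and its size is at most `(1 - ε / 2) |F|`.
  rcases lt_or_ge ((F \ U).card : ℝ) (η * F.card) with hsmall | hlarge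
  · have h1 := hM (F \ U)
    have h2 : M * (F \ U).card ≤ M * (η * F.card) := by gcongr
    have h3 : l / (1 - ε) * U.card ≤ l / (1 - ε) * F.card := by gcongr
    linarith
  · have hinv : IsAlmostInvariant E δ (F \ U) := by
      intro s hs
      have h1 : (((F \ U).image (fun x => x * s) \ (F \ U)).card : ℝ) ≤
          (F.image (fun x => x * s) \ F).card + T.card * (K.image (fun x => x * s) \ K).card := by
        exact_mod_cast card_image_sdiff_translates_le F T K s
      have h2 := hFE s hs
      have h3 := hKI s hs
      have h4 : (T.card : ℝ) * (K.image (fun x => x * s) \ K).card ≤ δ * η / 2 * F.card := by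
        calc (T.card : ℝ) * (K.image (fun x => x * s) \ K).card
            ≤ T.card * (δ * η * (1 - ε) / 2 * K.card) := by gcongr
          _ = δ * η / 2 * ((1 - ε) * (T.card * K.card)) := by ring
          _ ≤ δ * η / 2 * F.card := by
            gcongr
            exact hTcard.trans hUle
      have h5 : δ * (η * F.card) ≤ δ * (F \ U).card := by gcongr
      linarith
    have h1 := hP _ hinv
    have h2 : α * M * (F \ U).card ≤ α * M * ((1 - ε / 2) * F.card) := by
      gcongr
      linarith
    have h3 : (l / (1 - ε) + α * M) * ((F \ U).card : ℝ) =
      l / (1 - ε) * (F.card - U.card) + α * M * (F \ U).card := by rw [← hcardsd]; ring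
    rw [hη]
    linarith

/-- Fix `ε` with `l / (1 - ε) < b` and iterate `bound_step` from the trivial bound `M`: the excess
`(1 - ε / 2) ^ n * M` tends to `0`. -/
theorem FolnerIntegrable.bound_of_frequently_le {f : Pfin S → ℝ} (hf : FolnerIntegrable f)
    {l b : ℝ} (hl : 0 ≤ l) (hb : l < b)
    (hK : ∀ (E : Finset S) (δ : ℝ), 0 < δ → ∃ K : Finset S, K.Nonempty ∧
      IsAlmostInvariant E δ K ∧ Pfin.extend f K ≤ l * K.card) :
    ∃ (E : Finset S) (δ : ℝ), 0 < δ ∧ ∀ F : Finset S, IsAlmostInvariant E δ F →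
      Pfin.extend f F ≤ b * F.card := by
  obtain ⟨M, hM0, hM⟩ := hf.exists_extend_le_mul_card
  have hlim : Tendsto (fun ε : ℝ => l / (1 - ε)) (𝓝[>] 0) (𝓝 l) := by
    have : ContinuousAt (fun ε : ℝ => l / (1 - ε)) 0 :=
      continuousAt_const.div (by fun_prop) (by norm_num)
    have h := this.tendsto
    simp only [sub_zero, div_one] at h
    exact h.mono_left nhdsWithin_le_nhds
  obtain ⟨ε, ⟨hεb, hε1⟩, hε0⟩ := ((hlim.eventually_lt_const hb).and
    ((eventually_lt_nhds (zero_lt_one' ℝ)).filter_mono nhdsWithin_le_nhds)).and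
    self_mem_nhdsWithin |>.exists
  have hε0 : 0 < ε := hε0
  have hind : ∀ n : ℕ, ∃ (E : Finset S) (δ : ℝ), 0 < δ ∧ ∀ F : Finset S,
      IsAlmostInvariant E δ F →
      Pfin.extend f F ≤ (l / (1 - ε) + (1 - ε / 2) ^ n * M) * F.card := by
    intro n
    induction n with
    | zero =>
      refine ⟨∅, 1, one_pos, fun F _ => (hM F).trans ?_⟩
      have : 0 ≤ l / (1 - ε) := div_nonneg hl (by linarith)
      gcongr
      simpa using this
    | succ n ih =>
      simp only [pow_succ]
      exact hf.bound_step hM0 hM hl hε0 hε1 (pow_pos (by linarith) n) hK ih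
  have hpow : Tendsto (fun n : ℕ => l / (1 - ε) + (1 - ε / 2) ^ n * M) atTop
      (𝓝 (l / (1 - ε) + 0 * M)) :=
    ((tendsto_pow_atTop_nhds_zero_of_lt_one (by linarith) (by linarith)).mul_const M).const_add _
  rw [zero_mul, add_zero] at hpow
  obtain ⟨n, hn⟩ := (hpow.eventually_lt_const hεb).exists
  obtain ⟨E, δ, hδ, h⟩ := hind n
  refine ⟨E, δ, hδ, fun F hF => (h F hF).trans ?_⟩
  gcongr

/-- The Ornstein-Weiss lemma. -/
theorem FolnerIntegrable.exists_tendsto {f : Pfin S → ℝ} (hf : FolnerIntegrable f)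
    [hne : (folnerFilter S).NeBot] :
    ∃ a, Tendsto (fun F => f F / (F.1.card : ℝ)) (folnerFilter S) (𝓝 a) := by
  obtain ⟨M, hM0, hM⟩ := hf.exists_extend_le_mul_card
  -- The limit is the infimum of the eventual upper bounds, that is, the limit superior.
  set B : Set ℝ := {b | ∃ (E : Finset S) (δ : ℝ), 0 < δ ∧ ∀ F : Finset S,
    IsAlmostInvariant E δ F → Pfin.extend f F ≤ b * F.card} with hB
  have hB0 : ∀ b ∈ B, 0 ≤ b := by
    rintro b ⟨E, δ, hδ, h⟩
    obtain ⟨F, hF, hI⟩ := neBot_folnerFilter_iff.1 hne E δ hδ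
    have h1 := (hf.extend_nonneg F).trans (h F hI)
    exact nonneg_of_mul_nonneg_left h1 (by exact_mod_cast hF.card_pos)
  have hBne : B.Nonempty := ⟨M, ∅, 1, one_pos, fun F _ => hM F⟩
  have hBbdd : BddBelow B := ⟨0, hB0⟩
  have hpos : ∀ F : Pfin S, (0 : ℝ) < F.1.card := fun F => by exact_mod_cast F.2.card_pos
  refine ⟨sInf B, tendsto_order.2 ⟨fun l hl => ?_, fun b hb => ?_⟩⟩
  -- Otherwise averages at most `l` occur among arbitrarily invariant sets, so any `b > l` is an
  -- eventual upper bound, even one below the infimum.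
  · by_contra hcon
    have hfr : ∀ (E : Finset S) (δ : ℝ), 0 < δ → ∃ K : Finset S, K.Nonempty ∧
        IsAlmostInvariant E δ K ∧ Pfin.extend f K ≤ l * K.card := by
      intro E δ hδ
      by_contra! hno
      refine hcon (mem_folnerFilter.2 ⟨E, δ, hδ, fun F hF => ?_⟩)
      have := hno F.1 F.2 hF
      rw [Pfin.extend_coe] at this
      exact (lt_div_iff₀ (hpos F)).2 this
    have hl0 : 0 ≤ l := by
      obtain ⟨K, hK, _, hKl⟩ := hfr ∅ 1 one_pos
      exact nonneg_of_mul_nonneg_left ((hf.extend_nonneg K).trans hKl)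
        (by exact_mod_cast hK.card_pos)
    obtain ⟨b, hlb, hbB⟩ := exists_between hl
    exact (csInf_le hBbdd (hf.bound_of_frequently_le hl0 hlb hfr)).not_gt hbB
  · obtain ⟨c, ⟨E, δ, hδ, h⟩, hcb⟩ := exists_lt_of_csInf_lt hBne hb
    refine mem_folnerFilter.2 ⟨E, δ, hδ, fun F hF => ?_⟩
    have := h F.1 hF
    rw [Pfin.extend_coe] at this
    exact ((div_le_iff₀ (hpos F)).2 this).trans_lt hcb

theorem FolnerIntegrable.tendsto_folnerAverage {f : Pfin S → ℝ} (hf : FolnerIntegrable f)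
    [(folnerFilter S).NeBot] :
    Tendsto (fun F => f F / (F.1.card : ℝ)) (folnerFilter S) (𝓝 (folnerAverage f)) := by
  obtain ⟨a, ha⟩ := hf.exists_tendsto
  rwa [(isFolnerAverage_of_tendsto ha).folnerAverage_eq]

theorem FolnerIntegrable.isFolnerAverage {f : Pfin S → ℝ} (hf : FolnerIntegrable f)
    [(folnerFilter S).NeBot] : IsFolnerAverage f (folnerAverage f) :=
  isFolnerAverage_of_tendsto hf.tendsto_folnerAverage

end OrnsteinWeiss

/-! ### Finite sets, good extensions and transport of the class `𝒮`. -/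

theorem Pfin.card_pos {X : Type u} (A : Pfin X) : (0 : ℝ) < A.1.card := by
  exact_mod_cast A.2.card_pos

theorem Pfin.mem_image {X : Type u} {Y : Type v} {g : X → Y} {A : Pfin X} {y : Y} :
    y ∈ (A.image g).1 ↔ ∃ x ∈ A.1, g x = y := by
  classical
  simp [Pfin.image]

theorem Pfin.mem_union {X : Type u} {A B : Pfin X} {x : X} :
    x ∈ (A.union B).1 ↔ x ∈ A.1 ∨ x ∈ B.1 := by
  classical
  simp [Pfin.union]

theorem Pfin.mem_mul {S : Type u} [Mul S] {A B : Pfin S} {x : S} :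
    x ∈ (A.mul B).1 ↔ ∃ a ∈ A.1, ∃ b ∈ B.1, a * b = x := by
  classical
  simp [Pfin.mul, Finset.mem_mul]

theorem Pfin.ext {X : Type u} {A B : Pfin X} (h : ∀ x, x ∈ A.1 ↔ x ∈ B.1) : A = B :=
  Subtype.ext (Finset.ext h)

theorem Pfin.card_image {X : Type u} {Y : Type v} {g : X → Y} (hg : Function.Injective g)
    (A : Pfin X) : (A.image g).1.card = A.1.card := by
  classical
  exact Finset.card_image_of_injective _ hg

/-- `N` is (via `ι`) the kernel of `π`, and `σ` is a good section of `π`. -/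
structure IsGoodExtension {N : Type w} {S : Type u} {C : Type v} [Monoid N] [Monoid S] [Monoid C]
    (ι : N →* S) (π : S →* C) (σ : C → S) : Prop where
  injective : Function.Injective ι
  map_ι : ∀ n, π (ι n) = 1
  map_σ : ∀ c, π (σ c) = c
  exists_ι_mul : ∀ s, ∃ n, ι n * σ (π s) = s
  exists_mul_ι : ∀ s, ∃ n, σ (π s) * ι n = s

theorem IsGoodSection.isGoodExtension {S : Type u} {C : Type v} [Monoid S] [Monoid C]
    {π : S →* C} {σ : C → S} (hσ : IsGoodSection π σ) :
    IsGoodExtension (MonoidHom.mker π).subtype π σ where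
  injective := Subtype.val_injective
  map_ι n := n.2
  map_σ := hσ.1
  exists_ι_mul s := by
    have h : s ∈ π ⁻¹' {π (σ (π s))} := by simp [hσ.1]
    rw [← (hσ.2 (π s)).1] at h
    obtain ⟨n, hn, h⟩ := h
    exact ⟨⟨n, hn⟩, h⟩
  exists_mul_ι s := by
    have h : s ∈ π ⁻¹' {π (σ (π s))} := by simp [hσ.1]
    rw [← (hσ.2 (π s)).2] at h
    obtain ⟨n, hn, h⟩ := h
    exact ⟨⟨n, hn⟩, h⟩

open Classical in
/-- Multiplicative bijections preserve almost invariance. -/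
theorem tendsto_image_folnerFilter {N : Type u} [Mul N] (φ : N ≃* N) :
    Tendsto (Pfin.image φ) (folnerFilter N) (folnerFilter N) := by
  intro U hU
  obtain ⟨E, δ, hδ, h⟩ := mem_folnerFilter.1 hU
  refine mem_folnerFilter.2 ⟨E.image φ.symm, δ, hδ, fun F hF => h _ fun s hs => ?_⟩
  have h1 := hF (φ.symm s) (Finset.mem_image_of_mem _ hs)
  have h2 : ((F.image φ).1.image fun x => x * s) \ (F.image φ).1 =
      (F.1.image (fun x => x * φ.symm s) \ F.1).image φ := by
    rw [Finset.image_sdiff _ _ φ.injective]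
    congr 1
    simp only [Pfin.image, Finset.image_image]
    exact Finset.image_congr fun x _ => by simp
  rw [h2, Finset.card_image_of_injective _ φ.injective, Pfin.card_image φ.injective]
  exact h1

/-- With `D = σ(X)`, this makes the Ornstein-Weiss lemma available on the kernel. -/
theorem FolnerIntegrable.image_mul {N : Type w} {S : Type u} [Monoid N] [Monoid S]
    {f : Pfin S → ℝ} (hf : FolnerIntegrable f) (ι : N →* S) (D : Pfin S) : FolnerIntegrable fun Y : Pfin N => f ((Y.image ι).mul D) := by
  refine ⟨fun A B hAB => hf.increasing _ _ fun s => ?_, fun A B => ?_, fun n A => ?_⟩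
  · simp only [Pfin.mem_mul, Pfin.mem_image]
    rintro ⟨_, ⟨n, hn, rfl⟩, d, hd, rfl⟩
    exact ⟨_, ⟨n, hAB hn, rfl⟩, d, hd, rfl⟩
  · have e : ((A.union B).image ι).mul D = ((A.image ι).mul D).union ((B.image ι).mul D) := by
      refine Pfin.ext fun s => ?_
      simp only [Pfin.mem_mul, Pfin.mem_image, Pfin.mem_union]
      constructor
      · rintro ⟨_, ⟨n, hn | hn, rfl⟩, d, hd, rfl⟩
        · exact Or.inl ⟨_, ⟨n, hn, rfl⟩, d, hd, rfl⟩
        · exact Or.inr ⟨_, ⟨n, hn, rfl⟩, d, hd, rfl⟩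
      · rintro (⟨_, ⟨n, hn, rfl⟩, d, hd, rfl⟩ | ⟨_, ⟨n, hn, rfl⟩, d, hd, rfl⟩)
        · exact ⟨_, ⟨n, Or.inl hn, rfl⟩, d, hd, rfl⟩
        · exact ⟨_, ⟨n, Or.inr hn, rfl⟩, d, hd, rfl⟩
    simp only [e]
    exact hf.subadditive _ _
  · have e : ((A.image fun x => n * x).image ι).mul D =
        ((A.image ι).mul D).image fun x => ι n * x := by
      refine Pfin.ext fun s => ?_
      simp only [Pfin.mem_mul, Pfin.mem_image]
      constructor
      · rintro ⟨_, ⟨_, ⟨m, hm, rfl⟩, rfl⟩, d, hd, rfl⟩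
        exact ⟨_, ⟨_, ⟨m, hm, rfl⟩, d, hd, rfl⟩, by rw [map_mul, mul_assoc]⟩
      · rintro ⟨_, ⟨_, ⟨m, hm, rfl⟩, d, hd, rfl⟩, rfl⟩
        exact ⟨_, ⟨_, ⟨m, hm, rfl⟩, rfl⟩, d, hd, by rw [map_mul, mul_assoc]⟩
    simp only [e]
    exact hf.left_subinvariant _ _

/-! ### Factorization through a good section and the iterated limit. -/

namespace IsGoodExtension

variable {N : Type w} {S : Type u} {C : Type v} [Monoid N] [Monoid S] [IsCancelMul S] [Monoid C]
  {ι : N →* S} {π : S →* C} {σ : C → S} (h : IsGoodExtension ι π σ)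

include h

theorem isCancelMul : IsCancelMul N where
  mul_left_cancel a b c hbc := h.injective <| mul_left_cancel (a := ι a) <| by
    simpa using congrArg ι hbc
  mul_right_cancel a b c hbc := h.injective <| mul_right_cancel (b := ι a) <| by
    simpa using congrArg ι hbc

theorem ι_mul_inj {n n' : N} {c c' : C} (e : ι n * σ c = ι n' * σ c') : n = n' ∧ c = c' := by
  have hc : c = c' := by simpa [h.map_ι, h.map_σ] using congrArg π e
  subst hc
  exact ⟨h.injective (mul_right_cancel e), rfl⟩

theorem mul_ι_inj {n n' : N} {c c' : C} (e : σ c * ι n = σ c' * ι n') : n = n' ∧ c = c' := by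
  have hc : c = c' := by simpa [h.map_ι, h.map_σ] using congrArg π e
  subst hc
  exact ⟨h.injective (mul_left_cancel e), rfl⟩

/-- Give `A ⊆ N` the measure of `σ(C) A`. In the unique factorization `σ(c) n`, right multiplication
by `m ∈ N` changes only `n`, so invariance is inherited. -/
theorem rightAmenable (hS : RightAmenable S) : RightAmenable N := by
  obtain ⟨μ, h01, h1, hadd, hinv⟩ := hS
  let q : Set N → Set S := fun A => {s | ∃ c, ∃ n ∈ A, σ c * ι n = s}
  refine ⟨fun A => μ (q A), fun A => h01 _, ?_, fun A B hAB => ?_, fun m A => ?_⟩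
  · refine Eq.trans (congrArg μ ?_) h1
    refine Set.eq_univ_of_forall fun s => ?_
    obtain ⟨n, hn⟩ := h.exists_mul_ι s
    exact ⟨π s, n, trivial, hn⟩
  · refine Eq.trans (congrArg μ ?_) (hadd (q A) (q B) ?_)
    · ext s
      constructor
      · rintro ⟨c, n, hn | hn, rfl⟩
        · exact Or.inl ⟨c, n, hn, rfl⟩
        · exact Or.inr ⟨c, n, hn, rfl⟩
      · rintro (⟨c, n, hn, rfl⟩ | ⟨c, n, hn, rfl⟩)
        · exact ⟨c, n, Or.inl hn, rfl⟩
        · exact ⟨c, n, Or.inr hn, rfl⟩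
    · rw [Set.disjoint_left]
      rintro _ ⟨c, n, hn, rfl⟩ ⟨c', n', hn', e⟩
      rw [(h.mul_ι_inj e).1] at hn'
      exact Set.disjoint_left.1 hAB hn hn'
  · refine Eq.trans (congrArg μ ?_) (hinv (ι m) (q A))
    ext s
    constructor
    · rintro ⟨c, n, hn, rfl⟩
      exact ⟨c, n * m, hn, by simp only [map_mul, mul_assoc]⟩
    · rintro ⟨c, n, hn, e⟩
      obtain ⟨n', hn'⟩ := h.exists_mul_ι s
      refine ⟨π s, n', ?_, hn'⟩
      rw [← hn'] at e
      simp only [mul_assoc, ← map_mul ι] at e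
      rw [(h.mul_ι_inj e).1] at hn
      exact hn

/-- `N σ(c) = σ(c) N` with unique factorization on both sides, so conjugation by `σ(c)` makes sense
without inverses. -/
theorem exists_conj (c : C) : ∃ φ : N ≃* N, ∀ n, ι n * σ c = σ c * ι (φ n) := by
  have h1 : ∀ n, ∃ m, ι n * σ c = σ c * ι m := fun n => by
    obtain ⟨m, hm⟩ := h.exists_mul_ι (ι n * σ c)
    rw [map_mul, h.map_ι, h.map_σ, one_mul] at hm
    exact ⟨m, hm.symm⟩
  choose φ hφ using h1
  refine ⟨MulEquiv.ofBijective (MulHom.mk φ fun a b => ?_) ⟨fun a b hab => ?_, fun m => ?_⟩, hφ⟩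
  · refine (h.mul_ι_inj (c := c) (c' := c) ?_).1
    rw [← hφ, map_mul, mul_assoc, hφ, ← mul_assoc, hφ, map_mul, mul_assoc]
  · refine (h.ι_mul_inj (c := c) (c' := c) ?_).1
    rw [hφ a, hφ b]
    exact congrArg (fun x => σ c * ι x) hab
  · obtain ⟨n, hn⟩ := h.exists_ι_mul (σ c * ι m)
    rw [map_mul, h.map_ι, h.map_σ, mul_one, hφ] at hn
    exact ⟨n, (h.mul_ι_inj hn).1⟩

theorem card_mul (Y : Pfin N) (X : Pfin C) :
    ((Y.image ι).mul (X.image σ)).1.card = Y.1.card * X.1.card := by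
  classical
  have e : ((Y.image ι).mul (X.image σ)).1 = (Y.1 ×ˢ X.1).image fun p => ι p.1 * σ p.2 := by
    ext s
    simp only [Pfin.mem_mul, Pfin.mem_image, Finset.mem_image, Finset.mem_product, Prod.exists]
    constructor
    · rintro ⟨_, ⟨n, hn, rfl⟩, _, ⟨c, hc, rfl⟩, rfl⟩
      exact ⟨n, c, ⟨hn, hc⟩, rfl⟩
    · rintro ⟨n, c, ⟨hn, hc⟩, rfl⟩
      exact ⟨_, ⟨n, hn, rfl⟩, _, ⟨c, hc, rfl⟩, rfl⟩
  rw [e, Finset.card_image_of_injective, Finset.card_product]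
  rintro ⟨n, c⟩ ⟨n', c'⟩ e
  exact Prod.ext (h.ι_mul_inj e).1 (h.ι_mul_inj e).2

open Classical in
/-- Products `Y σ(X)` with `X` almost invariant in `C`, and then `Y` almost invariant in `N`, are
almost invariant in `S`. -/
theorem eventually_folnerFilter [IsCancelMul C] {U : Set (Pfin S)} (hU : U ∈ folnerFilter S) :
    ∀ᶠ X in folnerFilter C, ∀ᶠ Y in folnerFilter N, (Y.image ι).mul (X.image σ) ∈ U := by
  have := h.isCancelMul
  obtain ⟨E, δ, hδ, hEU⟩ := mem_folnerFilter.1 hU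
  filter_upwards [eventually_isAlmostInvariant (E.image π) (half_pos hδ)] with X hX
  -- `n s` is the `N`-component of `s`; it gives `σ(c) s = n(σ(c) s) σ(c π(s))`. Only finitely many
  -- such components occur once `X` is fixed, which is why `Y` is chosen after `X`.
  choose n hn using h.exists_ι_mul
  have hn' : ∀ c s, ι (n (σ c * s)) * σ (c * π s) = σ c * s := fun c s => by
    have := hn (σ c * s)
    rwa [map_mul, h.map_σ] at this
  filter_upwards [eventually_isAlmostInvariant
    ((X.1 ×ˢ E).image fun p => n (σ p.1 * p.2)) (half_pos hδ)] with Y hY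
  refine hEU _ fun s hs => ?_
  rw [h.card_mul]
  have hX' := hX (π s) (Finset.mem_image_of_mem _ hs)
  have hY' : ∀ c ∈ X.1, ((Y.1.image (fun x => x * n (σ c * s)) \ Y.1).card : ℝ) ≤
      δ / 2 * Y.1.card := fun c hc =>
    hY _ (Finset.mem_image.2 ⟨(c, s), Finset.mem_product.2 ⟨hc, hs⟩, rfl⟩)
  -- A point `y σ(c) s` leaves `Y σ(X)` only if `c π(s)` leaves `X` (set `A`) or `y n(σ(c) s)`
  -- leaves `Y` (set `B`).
  set A : Finset S := (Y.1 ×ˢ X.1.filter fun c => c * π s ∉ X.1).image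
    fun p => ι p.1 * (σ p.2 * s)
  set B : Finset S := X.1.biUnion fun c =>
    (Y.1.image (fun x => x * n (σ c * s)) \ Y.1).image fun m => ι m * σ (c * π s)
  have hsub : (((Y.image ι).mul (X.image σ)).1.image (fun x => x * s)) \
      ((Y.image ι).mul (X.image σ)).1 ⊆ A ∪ B := by
    intro u hu
    obtain ⟨hu1, hu2⟩ := Finset.mem_sdiff.1 hu
    obtain ⟨v, hv, rfl⟩ := Finset.mem_image.1 hu1
    obtain ⟨_, hy', _, hx, rfl⟩ := Pfin.mem_mul.1 hv
    obtain ⟨y, hy, rfl⟩ := Pfin.mem_image.1 hy'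
    obtain ⟨c, hc, rfl⟩ := Pfin.mem_image.1 hx
    by_cases hcX : c * π s ∈ X.1
    · refine Finset.mem_union_right _ (Finset.mem_biUnion.2 ⟨c, hc, Finset.mem_image.2
        ⟨y * n (σ c * s), Finset.mem_sdiff.2 ⟨Finset.mem_image_of_mem _ hy, fun hmem => hu2 ?_⟩,
          by rw [map_mul, mul_assoc, hn', mul_assoc]⟩⟩)
      exact Pfin.mem_mul.2 ⟨_, Pfin.mem_image.2 ⟨_, hmem, rfl⟩, _, Pfin.mem_image.2 ⟨_, hcX, rfl⟩,
        by rw [map_mul, mul_assoc, hn', mul_assoc]⟩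
    · exact Finset.mem_union_left _ (Finset.mem_image.2 ⟨(y, c), Finset.mem_product.2
        ⟨hy, Finset.mem_filter.2 ⟨hc, hcX⟩⟩, (mul_assoc _ _ _).symm⟩)
  have hA : (A.card : ℝ) ≤ Y.1.card * (δ / 2 * X.1.card) := by
    have h1 : A.card ≤ Y.1.card * (X.1.filter fun c => c * π s ∉ X.1).card :=
      Finset.card_image_le.trans (Finset.card_product _ _).le
    have h2 : (X.1.filter fun c => c * π s ∉ X.1).card ≤
        (X.1.image (fun x => x * π s) \ X.1).card :=
      Finset.card_le_card_of_injOn (fun c => c * π s) (fun c hc => by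
        have hc := Finset.mem_filter.1 hc
        exact Finset.mem_sdiff.2 ⟨Finset.mem_image_of_mem _ hc.1, hc.2⟩)
        fun x _ y _ hxy => mul_right_cancel hxy
    calc (A.card : ℝ) ≤ Y.1.card * (X.1.image (fun x => x * π s) \ X.1).card := by
          exact_mod_cast h1.trans (by gcongr)
      _ ≤ _ := by gcongr
  have hB : (B.card : ℝ) ≤ X.1.card * (δ / 2 * Y.1.card) := by
    calc (B.card : ℝ)
        ≤ ∑ c ∈ X.1, ((Y.1.image (fun x => x * n (σ c * s)) \ Y.1).card : ℝ) := by
          exact_mod_cast Finset.card_biUnion_le.trans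
            (Finset.sum_le_sum fun c _ => Finset.card_image_le)
      _ ≤ ∑ c ∈ X.1, δ / 2 * Y.1.card := Finset.sum_le_sum hY'
      _ = _ := by rw [Finset.sum_const, nsmul_eq_mul]
  have hAB : ((((Y.image ι).mul (X.image σ)).1.image (fun x => x * s) \
      ((Y.image ι).mul (X.image σ)).1).card : ℝ) ≤ A.card + B.card := by
    exact_mod_cast (Finset.card_le_card hsub).trans (Finset.card_union_le _ _)
  push_cast
  linarith

-- Approximate left subinvariance. As `σ(c) σ(x) = n σ(c x)` with `n ∈ N` and `Y` is nearly `Y n`,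
-- the set `Y σ(c x)` is nearly `Y σ(c) σ(x) = σ(c) φ(Y) σ(x)`; the error set `B` costs at most `M
-- |B|`.
open Classical in
theorem eventually_translate_le [IsCancelMul C] {f : Pfin S → ℝ} (hf : FolnerIntegrable f)
    {M : ℝ} (hM0 : 0 ≤ M) (hM : ∀ A : Finset S, Pfin.extend f A ≤ M * A.card) {c : C} {φ : N ≃* N}
    (hφ : ∀ n, ι n * σ c = σ c * ι (φ n)) (X : Pfin C) {δ : ℝ} (hδ : 0 < δ) :
    ∀ᶠ Y in folnerFilter N, f ((Y.image ι).mul ((X.image fun x => c * x).image σ)) ≤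
      f (((Y.image φ).image ι).mul (X.image σ)) + M * (X.1.card * (δ * Y.1.card)) := by
  have := h.isCancelMul
  choose n hn using h.exists_ι_mul
  have hn' : ∀ x, ι (n (σ c * σ x)) * σ (c * x) = σ c * σ x := fun x => by
    have := hn (σ c * σ x)
    rwa [map_mul, h.map_σ, h.map_σ] at this
  filter_upwards [eventually_isAlmostInvariant (X.1.image fun x => n (σ c * σ x)) hδ] with Y hY
  set B : Finset S := X.1.biUnion fun x =>
    (Y.1 \ Y.1.image fun y => y * n (σ c * σ x)).image fun m => ι m * σ (c * x)
  set A := ((Y.image φ).image ι).mul (X.image σ)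
  have hsub : ((Y.image ι).mul ((X.image fun x => c * x).image σ)).1 ⊆
      A.1.image (fun a => σ c * a) ∪ B := by
    intro u hu
    obtain ⟨_, hy', _, hx', rfl⟩ := Pfin.mem_mul.1 hu
    obtain ⟨y, hy, rfl⟩ := Pfin.mem_image.1 hy'
    obtain ⟨_, hcx, rfl⟩ := Pfin.mem_image.1 hx'
    obtain ⟨x, hx, rfl⟩ := Pfin.mem_image.1 hcx
    by_cases hyn : y ∈ Y.1.image fun y => y * n (σ c * σ x)
    · obtain ⟨y', hyY, rfl⟩ := Finset.mem_image.1 hyn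
      refine Finset.mem_union_left _ (Finset.mem_image.2 ⟨ι (φ y') * σ x, ?_, ?_⟩)
      · exact Pfin.mem_mul.2 ⟨_, Pfin.mem_image.2 ⟨_, Pfin.mem_image.2 ⟨y', hyY, rfl⟩, rfl⟩, _,
          Pfin.mem_image.2 ⟨x, hx, rfl⟩, rfl⟩
      · rw [map_mul, mul_assoc, hn', ← mul_assoc, ← mul_assoc, hφ]
    · exact Finset.mem_union_right _ (Finset.mem_biUnion.2 ⟨x, hx, Finset.mem_image_of_mem _
        (Finset.mem_sdiff.2 ⟨hy, hyn⟩)⟩)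
  have hB : (B.card : ℝ) ≤ X.1.card * (δ * Y.1.card) := by
    calc (B.card : ℝ)
        ≤ ∑ x ∈ X.1, ((Y.1.image (fun y => y * n (σ c * σ x)) \ Y.1).card : ℝ) := by
          exact_mod_cast Finset.card_biUnion_le.trans
            (Finset.sum_le_sum fun x _ => Finset.card_image_le.trans
              (card_image_mul_right_sdiff_comm Y.1 (n (σ c * σ x))).le)
      _ ≤ ∑ x ∈ X.1, δ * Y.1.card := Finset.sum_le_sum fun x hx =>
          hY _ (Finset.mem_image_of_mem _ hx)
      _ = _ := by rw [Finset.sum_const, nsmul_eq_mul]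
  rw [← Pfin.extend_coe f, ← Pfin.extend_coe f A]
  calc _ ≤ _ := hf.extend_mono hsub
    _ ≤ _ := hf.extend_union_le _ _
    _ ≤ _ := add_le_add (hf.extend_image_mul_left_le _ _)
      ((hM B).trans (mul_le_mul_of_nonneg_left hB hM0))

theorem folnerIntegrable_theta [IsCancelMul C] [(folnerFilter N).NeBot] {f : Pfin S → ℝ}
    (hf : FolnerIntegrable f) {Θ : Pfin C → ℝ}
    (hΘ : ∀ X : Pfin C, Tendsto (fun Y : Pfin N => f ((Y.image ι).mul (X.image σ)) / Y.1.card)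
      (folnerFilter N) (𝓝 (Θ X))) : FolnerIntegrable Θ := by
  refine ⟨fun A B hAB => ?_, fun A B => ?_, fun c X => ?_⟩
  · refine le_of_tendsto_of_tendsto' (hΘ A) (hΘ B) fun Y => ?_
    gcongr
    refine hf.increasing _ _ fun s => ?_
    simp only [Pfin.mem_mul, Pfin.mem_image]
    rintro ⟨y, hy, _, ⟨x, hx, rfl⟩, rfl⟩
    exact ⟨y, hy, _, ⟨x, hAB hx, rfl⟩, rfl⟩
  · refine le_of_tendsto_of_tendsto' (hΘ _) ((hΘ A).add (hΘ B)) fun Y => ?_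
    rw [← add_div]
    gcongr
    refine le_trans (hf.increasing _ _ fun s => ?_) (hf.subadditive _ _)
    simp only [Pfin.mem_mul, Pfin.mem_image, Pfin.mem_union]
    rintro ⟨y, hy, _, ⟨x, hx | hx, rfl⟩, rfl⟩
    · exact Or.inl ⟨y, hy, _, ⟨x, hx, rfl⟩, rfl⟩
    · exact Or.inr ⟨y, hy, _, ⟨x, hx, rfl⟩, rfl⟩
  · obtain ⟨M, hM0, hM⟩ := hf.exists_extend_le_mul_card
    obtain ⟨φ, hφ⟩ := h.exists_conj c
    -- The automorphism `φ` preserves the Følner filter, so the averages over `φ(Y)` still tend to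
    -- `Θ X`.
    have key : ∀ δ : ℝ, 0 < δ → Θ (X.image fun x => c * x) ≤ Θ X + M * (X.1.card * δ) := by
      intro δ hδ
      refine le_of_tendsto_of_tendsto (hΘ _)
        (((hΘ X).comp (tendsto_image_folnerFilter φ)).add_const _) ?_
      filter_upwards [h.eventually_translate_le hf hM0 hM hφ X hδ] with Y hY
      simp only [Function.comp_apply]
      rw [Pfin.card_image φ.injective, div_add' _ _ _ Y.card_pos.ne']
      refine div_le_div_of_nonneg_right ?_ Y.card_pos.le
      linarith
    have hlim : Tendsto (fun δ : ℝ => Θ X + M * (X.1.card * δ)) (𝓝[>] 0) (𝓝 (Θ X)) := by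
      have : Continuous fun δ : ℝ => Θ X + M * (X.1.card * δ) := by fun_prop
      have := this.tendsto 0
      simp only [mul_zero, add_zero] at this
      exact this.mono_left nhdsWithin_le_nhds
    exact ge_of_tendsto hlim (eventually_nhdsWithin_of_forall key)

theorem tendsto_theta [IsCancelMul C] [(folnerFilter N).NeBot] {f : Pfin S → ℝ} {a : ℝ}
    (ha : Tendsto (fun F => f F / (F.1.card : ℝ)) (folnerFilter S) (𝓝 a)) {Θ : Pfin C → ℝ}
    (hΘ : ∀ X : Pfin C, Tendsto (fun Y : Pfin N => f ((Y.image ι).mul (X.image σ)) / Y.1.card)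
      (folnerFilter N) (𝓝 (Θ X))) :
    Tendsto (fun X => Θ X / (X.1.card : ℝ)) (folnerFilter C) (𝓝 a) := by
  rw [(Metric.nhds_basis_closedBall).tendsto_right_iff]
  intro ε hε
  filter_upwards [h.eventually_folnerFilter (ha (Metric.closedBall_mem_nhds a hε))] with X hX
  -- Closed balls survive the inner limit in `Y`, so no uniformity in `X` is needed.
  refine Metric.isClosed_closedBall.mem_of_tendsto ((hΘ X).div_const _) ?_
  filter_upwards [hX] with Y hY
  rw [div_div]
  have := h.card_mul Y X
  simpa [this] using hY

end IsGoodExtension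

theorem mainTheorem4 {S : Type u} {C : Type v} [Monoid S] [IsCancelMul S] [Monoid C]
    [IsCancelMul C] (hS : RightAmenable S) (hC : RightAmenable C) (π : S →* C)
    (hπ : Function.Surjective π) (σ : C → S) (hσ : IsGoodSection π σ) (f : Pfin S → ℝ)
    (hf : FolnerIntegrable f) :
    RightAmenable (MonoidHom.mker π) ∧
    (∀ X : Pfin C,
      IsFolnerAverage (restrictPfin (MonoidHom.mker π) (rightTranslate f (X.image σ)))
        (folnerTheta π σ f X)) ∧
    FolnerIntegrable (folnerTheta π σ f) ∧
    IsFolnerAverage f (folnerAverage f) ∧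
    IsFolnerAverage (folnerTheta π σ f) (folnerAverage (folnerTheta π σ f)) ∧
    folnerAverage f = folnerAverage (folnerTheta π σ f) := by
  have h := hσ.isGoodExtension
  have hN := h.rightAmenable hS
  have := h.isCancelMul
  have := hS.neBot_folnerFilter
  have := hC.neBot_folnerFilter
  have := hN.neBot_folnerFilter
  have hfX : ∀ X : Pfin C, FolnerIntegrable
      (restrictPfin (MonoidHom.mker π) (rightTranslate f (X.image σ))) := fun X =>
    hf.image_mul (MonoidHom.mker π).subtype (X.image σ)
  have hΘ := fun X => (hfX X).tendsto_folnerAverage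
  have havg := isFolnerAverage_of_tendsto (h.tendsto_theta hf.tendsto_folnerAverage hΘ)
  have heq := havg.folnerAverage_eq
  refine ⟨hN, fun X => (hfX X).isFolnerAverage, h.folnerIntegrable_theta hf hΘ, hf.isFolnerAverage,
    ?_, heq.symm⟩
  -- `havg` concerns the inner averages on the kernel, which are `folnerTheta π σ f` by definition.
  · change IsFolnerAverage (folnerTheta π σ f) _ at havg
    change folnerAverage (folnerTheta π σ f) = _ at heq
    rwa [heq]
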